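/- Let $S$ be a closed oriented surface. **Pseudo-Anosov homeomorphisms.** A homeomorphism $f:S\to S$ preserving the orientation is a (generalized) pseudo-Anosov homeomorphism if there are $\lambda>1$ and two transverse measured foliations $(\mathcal F^s,\mu^s)$, $(\mathcal F^u,\mu^u)$ of $S$, with $k$-prong singularities, $k\ge 1$, $k\neq 2$ (so spines, $k=1$, are allowed), that are invariant under $f$ and satisfy $\mu^s(f(\gamma))=\lambda\,\mu^s(\gamma)$ and $\mu^u(f(\gamma))=\lambda^{-1}\mu^u(\gamma)$ for every arc $\gamma$, where $\mu^s,\mu^u$ are the measures transverse to the stable foliation $\mathcal F^s$ and to the unstable foliation $\mathcal F^u$. **Rectangles.** A nonempty connected open set $r$ is trivially bi-foliated if for all $x,y\in r$ the closures $I_x$, $J_y$ of the connected components of $\mathcal F^s_x\cap r$ and $\mathcal F^u_y\cap r$ containing $x$ and $y$ are closed intervals that meet in exactly one point, which lies in $r$. A rectangle is the closure $R=\overline r$ of such a set, with interior $\overset{o}{R}=r$. A parametrization of $R$ is a continuous immersion $[0,1]^2\to S$ with image $R$ that restricts to an orientation-preserving homeomorphism $(0,1)^2\to\overset{o}{R}$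 and embeds each horizontal line in a stable leaf and each vertical line in an unstable leaf. A geometric rectangle is a rectangle with an orientation of its vertical leaves (the vertical direction) induced through a parametrization by an orientation of the vertical lines of the square; its horizontal direction is the one that makes (horizontal, vertical) agree with the orientation of $S$. A horizontal (vertical) subrectangle of $R$ is a rectangle contained in $R$ whose open stable (unstable) plaques are those of $R$. **Geometric Markov partitions.** A geometric Markov partition of $f$ is a labeled finite family $\mathcal R=\{R_i\}_{i=1}^n$ of geometric rectangles that cover $S$, have pairwise disjoint interiors, and are such that for all $i,j$ the closure of each connected component of $\overset{o}{R_i}\cap f^{-1}(\overset{o}{R_j})$ is a horizontal subrectangle of $R_i$ and the closure of each connected component of $f(\overset{o}{R_i})\cap\overset{o}{R_j}$ is a vertical subrectangle of $R_j$. **Geometric types.** Let $H^i_1,\dots,H^i_{h_i}$ be the closures of the connected components of $\overset{o}{R_i}\cap\bigcup_j f^{-1}(\overset{o}{R_j})$, ordered from bottom to top for the vertical direction of $R_i$, and let $V^k_1,\dots,V^k_{v_k}$ be the closures of the connected components of $\overset{o}{R_k}\cap\bigcup_i f(\overset{o}{R_i})$, ordered from left to right for the horizontal direction of $R_k$. The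 geometric type of $(f,\mathcal R)$ is $T(f,\mathcal R)=(n,\{(h_i,v_i)\}_{i=1}^n,\rho,\epsilon)$, where $\rho$ is the bijection from the labels $(i,j)$, $1\le j\le h_i$, to the labels $(k,l)$, $1\le l\le v_k$, with $\rho(i,j)=(k,l)$ if and only if $f(H^i_j)=V^k_l$, and $\epsilon(i,j)\in\{1,-1\}$ is $1$ if and only if $f$ maps the vertical direction of $H^i_j$ (that of $R_i$) to the vertical direction of $V^k_l$ (that of $R_k$), where $(k,l)=\rho(i,j)$. **Theorem.** Let $f$ be a generalized pseudo-Anosov homeomorphism of $S$ with invariant measured foliations $(\mathcal F^s,\mu^s)$, $(\mathcal F^u,\mu^u)$, let $h:S\to S$ be an orientation-preserving homeomorphism, and let $g=h\circ f\circ h^{-1}$. Let $\mathcal R=\{R_i\}_{i=1}^n$ be a geometric Markov partition of $f$, and let $h(\mathcal R)=\{h(R_i)\}_{i=1}^n$, each $h(R_i)$ carrying the images by $h$ of the vertical and horizontal directions of $R_i$. Then $g$ is a generalized pseudo-Anosov homeomorphism with invariant measured foliations $h_*(\mathcal F^s,\mu^s)$, $h_*(\mathcal F^u,\mu^u)$,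 the family $h(\mathcal R)$ is a geometric Markov partition of $g$ for these foliations, and the geometric types of $(f,\mathcal R)$ and $(g,h(\mathcal R))$ are the same: a tuple $T$ is the geometric type of $(f,\mathcal R)$ if and only if it is the geometric type of $(g,h(\mathcal R))$, and if $T$ is the geometric type of $(f,\mathcal R)$ and $T'$ that of $(g,h(\mathcal R))$, then $T=T'$. -/

import Mathlib

open Set Topology
open scoped unitInterval ENNReal

/-! ### Orientation of surfaces and orientation-preserving homeomorphisms -/

/-- The closed curve `γ : [0,1] → ℂ ∖ {p}` has winding number `k` around `p`: it can be written as
`γ = p + exp θ` with `θ` continuous and `θ 1 - θ 0 = 2πik`. -/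
def HasWindingNumber (γ : ℝ → ℂ) (p : ℂ) (k : ℤ) : Prop :=
  ∃ θ : ℝ → ℂ, ContinuousOn θ (Icc 0 1) ∧ (∀ t ∈ Icc (0 : ℝ) 1, γ t = p + Complex.exp (θ t)) ∧
    θ 1 - θ 0 = 2 * Real.pi * Complex.I * k

/-- A local homeomorphism `φ` of the plane preserves the orientation at `z` (has local degree `1`)
if it preserves the winding numbers of the small closed curves around `z`, that is, if it acts by
`+1` on the first homology `ℤ` of a small punctured disc around `z`. -/
def PreservesWindingAt (φ : ℂ → ℂ) (z : ℂ) : Prop :=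
  ∃ r > 0, ∀ (γ : ℝ → ℂ) (k : ℤ), (∀ t ∈ Icc (0 : ℝ) 1, γ t ∈ Metric.ball z r) →
    HasWindingNumber γ z k → HasWindingNumber (φ ∘ γ) (φ z) k

/-- The atlas of the topological surface `S` is an oriented atlas: the changes of charts preserve
the orientation of the plane. -/
class OrientedSurface (S : Type*) [TopologicalSpace S] [ChartedSpace ℂ S] : Prop where
  compatible : ∀ e ∈ atlas ℂ S, ∀ e' ∈ atlas ℂ S, ∀ p ∈ e.source ∩ e'.source,
    PreservesWindingAt (e' ∘ e.symm) (e p)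

section Surface

variable {S : Type*} [TopologicalSpace S]

/-- A homeomorphism of an oriented surface preserves the orientation (read in oriented charts). -/
def OrientationPreserving [ChartedSpace ℂ S] (h : S ≃ₜ S) : Prop :=
  ∀ e ∈ atlas ℂ S, ∀ e' ∈ atlas ℂ S, ∀ p ∈ e.source, h p ∈ e'.source →
    PreservesWindingAt (e' ∘ h ∘ e.symm) (e p)

/-! ### Transverse measured foliations with prong singularities -/

variable (S) in
/-- A transverse measure, as an additive function on the paths of the surface: the measure of a
path is the total variation of the transverse coordinate along it (this is imposed by the charts
of `IsTransversePair` below). -/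
structure TransverseMeasure where
  toFun : C(I, S) → ℝ≥0∞
  map_trans : ∀ {x y z : S} (p : Path x y) (q : Path y z),
    toFun (p.trans q).toContinuousMap = toFun p.toContinuousMap + toFun q.toContinuousMap

/-- The push-forward `h_* μ` of a transverse measure by a homeomorphism:
`(h_* μ)(γ) = μ (h⁻¹ ∘ γ)`. -/
def TransverseMeasure.map (μ : TransverseMeasure S) (h : S ≃ₜ S) : TransverseMeasure S where
  toFun γ := μ.toFun ((h.symm : C(S, S)).comp γ)
  map_trans p q := by
    have := μ.map_trans (p.map h.symm.continuous) (q.map h.symm.continuous)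
    rw [← Path.map_trans] at this
    exact this

/-- The leaf through `x` of the foliation with transverse measure `μ`: the points that can be
joined to `x` by a path tangent to the foliation, that is, a path of zero transverse measure.
The leaf through a singular point is the union of this point and of its separatrices. -/
def leaf (μ : TransverseMeasure S) (x : S) : Set S :=
  {y | ∃ γ : Path x y, μ.toFun γ.toContinuousMap = 0}

/-- The distance `|Im z^(k/2)|` of `z` to the singular leaf of the stable model foliation with `k`
prongs at the origin of the plane, whose leaves are the level curves of `Im z^(k/2)`. -/
noncomputable def prongHeight (k : ℕ) (z : ℂ) : ℝ := |(z ^ ((k : ℂ) / 2)).im|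

/-- The distance `|Re z^(k/2)|` of `z` to the singular leaf of the unstable model foliation with
`k` prongs at the origin of the plane, whose leaves are the level curves of `Re z^(k/2)`. -/
noncomputable def prongWidth (k : ℕ) (z : ℂ) : ℝ := |(z ^ ((k : ℂ) / 2)).re|

/-- `μs` and `μu` are the transverse measures of two transverse measured foliations, possibly with
singularities and spines: around every point `p` there is a chart to the plane that carries them
to the pair of standard foliations `|Im d(z^(k/2))|` and `|Re d(z^(k/2))|`, for some `k ≥ 1`.
The point is regular if `k = 2` (horizontal and vertical lines with `|dy|` and `|dx|`), a spine if
`k = 1`, and a `k`-prong singularity if `k ≥ 3`. -/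
def IsTransversePair (μs μu : TransverseMeasure S) : Prop :=
  ∀ p : S, ∃ k : ℕ, 1 ≤ k ∧ ∃ φ : OpenPartialHomeomorph S ℂ, p ∈ φ.source ∧ φ p = 0 ∧
    ∀ γ : C(I, S), (∀ t, γ t ∈ φ.source) →
      μs.toFun γ = eVariationOn (fun t => prongHeight k (φ (γ t))) univ ∧
      μu.toFun γ = eVariationOn (fun t => prongWidth k (φ (γ t))) univ

/-- `f` is a (generalized) pseudo-Anosov homeomorphism with stable foliation given by `μs` and
unstable foliation given by `μu`: it dilates by `stretch > 1` the measure transverse to the stable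
foliation (the measure of unstable arcs) and contracts by the same factor the measure transverse
to the unstable foliation (the measure of stable arcs). In particular, `f` maps stable leaves to
stable leaves and unstable leaves to unstable leaves. -/
structure IsPseudoAnosov [ChartedSpace ℂ S] (f : S ≃ₜ S) (μs μu : TransverseMeasure S) : Prop where
  orientationPreserving : OrientationPreserving f
  transverse : IsTransversePair μs μu
  stretch : ∃ lam : ℝ, 1 < lam ∧ ∀ γ : C(I, S),
    μs.toFun ((f : C(S, S)).comp γ) = ENNReal.ofReal lam * μs.toFun γ ∧
    μu.toFun ((f : C(S, S)).comp γ) = ENNReal.ofReal lam⁻¹ * μu.toFun γ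

/-! ### Rectangles -/

/-- The open plaque through `x` in `r`: the connected component containing `x` of the intersection
of `r` with the leaf through `x`. -/
def plaque (μ : TransverseMeasure S) (r : Set S) (x : S) : Set S :=
  connectedComponentIn (leaf μ x ∩ r) x

/-- The open connected set `r` is trivially bi-foliated: the closures `I_x` and `J_y` of the stable
and unstable plaques are closed intervals, and `I_x ∩ J_y` is a single point, which lies in `r`. -/
structure TriviallyBifoliated (μs μu : TransverseMeasure S) (r : Set S) : Prop where
  isOpen : IsOpen r
  isConnected : IsConnected r
  stable_interval : ∀ x ∈ r, Nonempty (closure (plaque μs r x) ≃ₜ I)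
  unstable_interval : ∀ x ∈ r, Nonempty (closure (plaque μu r x) ≃ₜ I)
  inter : ∀ x ∈ r, ∀ y ∈ r, ∃ z ∈ r, closure (plaque μs r x) ∩ closure (plaque μu r y) = {z}

/-- `H` is a horizontal subrectangle of the rectangle whose interior is `r`. -/
def IsHorizontalSubrectangle (μs μu : TransverseMeasure S) (r H : Set S) : Prop :=
  ∃ r' : Set S, TriviallyBifoliated μs μu r' ∧ H = closure r' ∧ H ⊆ closure r ∧
    ∀ x ∈ r', plaque μs r' x = plaque μs r x

/-- `V` is a vertical subrectangle of the rectangle whose interior is `r`. -/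
def IsVerticalSubrectangle (μs μu : TransverseMeasure S) (r V : Set S) : Prop :=
  ∃ r' : Set S, TriviallyBifoliated μs μu r' ∧ V = closure r' ∧ V ⊆ closure r ∧
    ∀ x ∈ r', plaque μu r' x = plaque μu r x

/-- The closed unit square. -/
def closedSquare : Set (ℝ × ℝ) := Icc 0 1 ×ˢ Icc 0 1

/-- The open unit square. -/
def openSquare : Set (ℝ × ℝ) := Ioo 0 1 ×ˢ Ioo 0 1

variable (S) in
/-- The data of a geometric rectangle: a parametrization by the unit square (only its values on
the closed square matter) and an orientation `±1` of the vertical lines of the square. -/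
structure GeometricRectangle where
  param : ℝ × ℝ → S
  dir : ℤˣ

namespace GeometricRectangle

/-- The interior of the rectangle: the image of the open square. -/
def inner (R : GeometricRectangle S) : Set S := R.param '' openSquare

/-- The rectangle itself: the image of the closed square. -/
def carrier (R : GeometricRectangle S) : Set S := R.param '' closedSquare

/-- `a` comes strictly before `b` for the chosen orientation of the vertical lines of the square,
or for the associated orientation of its horizontal lines. These are either up and right, or down
and left, so that (horizontal, vertical) is always the standard orientation of the plane. -/
def Before (R : GeometricRectangle S) (a b : ℝ) : Prop := 0 < ((R.dir : ℤ) : ℝ) * (b - a)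

/-- `x` and `y` are points of the interior of the rectangle that lie on the same vertical leaf, and
`y` comes after `x` in the vertical direction. -/
def VerticalBefore (R : GeometricRectangle S) (x y : S) : Prop :=
  ∃ s t t' : ℝ, (s, t) ∈ openSquare ∧ (s, t') ∈ openSquare ∧
    R.param (s, t) = x ∧ R.param (s, t') = y ∧ R.Before t t'

/-- In the interior of the rectangle, the subset `A` lies entirely below the subset `B`, for the
vertical direction, except for common boundary leaves. -/
def Below (R : GeometricRectangle S) (A B : Set S) : Prop :=
  ∀ a ∈ openSquare, ∀ b ∈ openSquare, R.param a ∈ A → R.param b ∈ B → ¬ R.Before b.2 a.2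

/-- In the interior of the rectangle, the subset `A` lies entirely to the left of the subset `B`,
for the horizontal direction, except for common boundary leaves. -/
def LeftOf (R : GeometricRectangle S) (A B : Set S) : Prop :=
  ∀ a ∈ openSquare, ∀ b ∈ openSquare, R.param a ∈ A → R.param b ∈ B → ¬ R.Before b.1 a.1

/-- The image of a geometric rectangle by a homeomorphism `h`, with the vertical and the horizontal
directions carried by `h`. -/
def map (R : GeometricRectangle S) (h : S ≃ₜ S) : GeometricRectangle S where
  param := h ∘ R.param
  dir := R.dir

/-- The data `R` is a geometric rectangle for the given pair of foliations: its interior is a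
trivially bi-foliated set, whose closure is parametrized by a continuous immersion of the square
which is an orientation-preserving homeomorphism of the open square onto the interior, and which
embeds horizontal lines in stable leaves and vertical lines in unstable leaves. -/
structure IsRectangle [ChartedSpace ℂ S] (μs μu : TransverseMeasure S)
    (R : GeometricRectangle S) : Prop where
  bifoliated : TriviallyBifoliated μs μu R.inner
  carrier_eq : R.carrier = closure R.inner
  continuousOn : ContinuousOn R.param closedSquare
  locally_injective : ∀ a ∈ closedSquare, ∃ U ∈ 𝓝 a, InjOn R.param (U ∩ closedSquare)
  isOpenEmbedding : IsOpenEmbedding (openSquare.domRestrict R.param)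
  orientationPreserving : ∀ e ∈ atlas ℂ S, ∀ z : ℂ, (z.re, z.im) ∈ openSquare →
    R.param (z.re, z.im) ∈ e.source → PreservesWindingAt (fun w => e (R.param (w.re, w.im))) z
  horizontal : ∀ t ∈ Icc (0 : ℝ) 1, (∃ x, R.param '' (Icc 0 1 ×ˢ {t}) ⊆ leaf μs x) ∧
    InjOn R.param (Icc 0 1 ×ˢ {t})
  vertical : ∀ s ∈ Icc (0 : ℝ) 1, (∃ x, R.param '' ({s} ×ˢ Icc 0 1) ⊆ leaf μu x) ∧
    InjOn R.param ({s} ×ˢ Icc 0 1)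

end GeometricRectangle

/-! ### Geometric Markov partitions and geometric types -/

/-- The labeled family `R` is a geometric Markov partition of the pseudo-Anosov homeomorphism `f`
with stable and unstable foliations given by `μs` and `μu`. -/
structure IsGeometricMarkovPartition [ChartedSpace ℂ S] (f : S ≃ₜ S) (μs μu : TransverseMeasure S)
    {n : ℕ} (R : Fin n → GeometricRectangle S) : Prop where
  isRectangle : ∀ i, (R i).IsRectangle μs μu
  cover : ⋃ i, (R i).carrier = univ
  disjoint : ∀ i j, i ≠ j → Disjoint (R i).inner (R j).inner
  horizontal : ∀ i j, ∀ x ∈ (R i).inner ∩ f ⁻¹' (R j).inner,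
    IsHorizontalSubrectangle μs μu (R i).inner
      (closure (connectedComponentIn ((R i).inner ∩ f ⁻¹' (R j).inner) x))
  vertical : ∀ i j, ∀ x ∈ f '' (R i).inner ∩ (R j).inner,
    IsVerticalSubrectangle μs μu (R j).inner
      (closure (connectedComponentIn (f '' (R i).inner ∩ (R j).inner) x))

/-- The closures of the connected components of a set. -/
def componentClosures (A : Set S) : Set (Set S) :=
  {K | ∃ x ∈ A, K = closure (connectedComponentIn A x)}

/-- The set of the horizontal subrectangles of `(f, R)` contained in the `i`-th rectangle. -/
def horizontalSubrectangles (f : S ≃ₜ S) {n : ℕ} (R : Fin n → GeometricRectangle S) (i : Fin n) :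
    Set (Set S) :=
  componentClosures ((R i).inner ∩ ⋃ j, f ⁻¹' (R j).inner)

/-- The set of the vertical subrectangles of `(f, R)` contained in the `k`-th rectangle. -/
def verticalSubrectangles (f : S ≃ₜ S) {n : ℕ} (R : Fin n → GeometricRectangle S) (k : Fin n) :
    Set (Set S) :=
  componentClosures ((R k).inner ∩ ⋃ i, f '' (R i).inner)

/-- Let `H` be a horizontal subrectangle of `R` which `f` maps onto a vertical subrectangle of
`R'`. The map `f` sends the vertical direction of `H` to the vertical direction of its image. -/
def PreservesVerticalDirection (f : S ≃ₜ S) (R R' : GeometricRectangle S) (H : Set S) : Prop :=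
  ∀ x ∈ H, ∀ y ∈ H, f x ∈ R'.inner → f y ∈ R'.inner →
    R.VerticalBefore x y → R'.VerticalBefore (f x) (f y)

end Surface

/-- An abstract geometric type `(n, (h_i, v_i), ρ, ε)`. The labels `(i, j)` are numbered from `0`. -/
structure GeometricType (n : ℕ) where
  h : Fin n → ℕ
  v : Fin n → ℕ
  ρ : (Σ i, Fin (h i)) ≃ (Σ k, Fin (v k))
  ε : (Σ i, Fin (h i)) → ℤˣ

/-- `T` is the geometric type of the geometric Markov partition `R` of `f`. Here `H i j` is the
`j`-th horizontal subrectangle of the `i`-th rectangle, from bottom to top, and `V k l` is the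
`l`-th vertical subrectangle of the `k`-th rectangle, from left to right. -/
def IsGeometricTypeOf {S : Type*} [TopologicalSpace S] {n : ℕ} (T : GeometricType n) (f : S ≃ₜ S)
    (R : Fin n → GeometricRectangle S) : Prop :=
  ∃ (H : ∀ i, Fin (T.h i) → Set S) (V : ∀ k, Fin (T.v k) → Set S),
    (∀ i, (H i).Injective ∧ range (H i) = horizontalSubrectangles f R i ∧
      ∀ j j', j < j' → (R i).Below (H i j) (H i j')) ∧
    (∀ k, (V k).Injective ∧ range (V k) = verticalSubrectangles f R k ∧
      ∀ l l', l < l' → (R k).LeftOf (V k l) (V k l')) ∧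
    (∀ a b, T.ρ a = b ↔ f '' H a.1 a.2 = V b.1 b.2) ∧
    (∀ a, T.ε a = 1 ↔
      PreservesVerticalDirection f (R a.1) (R (T.ρ a).1) (H a.1 a.2))

/-!
Every notion in the statement is defined by the topology of `S`, the transverse measures and the
orientation, so the first three assertions amount to transport of structure along `h`. Leaves,
plaques, closures and connected components are carried by `h` to the corresponding objects for the
pushed-forward measures, and `g ∘ h = h ∘ f`.

The orientation needs an argument, since it is defined by winding numbers in charts. Local maps that
preserve winding numbers compose (`PreservesWindingAt.comp`), and so do their local inverses
(`PreservesWindingAt.of_rightInverse`): the inverse image of a closed curve has *some* winding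
number, because curves lift through `exp`, and this number is the right one, because winding numbers
are unique. Hence the orientation-preserving homeomorphisms form a group, which contains `g`.

The last assertion then reduces to the uniqueness of the geometric type of `(f, R)`. The relations
`Below` and `LeftOf` determine the order of the subrectangles, since two subrectangles cannot each
lie below the other: being closures of nonempty open subsets of the open rectangle, they contain
points at distinct heights. Thus the enumerations `H` and `V` are unique, and they determine `ρ` and
`ε`.
-/

/-! ### Winding numbers -/

theorem HasWindingNumber.unique {γ : ℝ → ℂ} {p : ℂ} {k k' : ℤ} (hk : HasWindingNumber γ p k)
    (hk' : HasWindingNumber γ p k') : k = k' := by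
  obtain ⟨θ, hθ, hγ, h1⟩ := hk
  obtain ⟨θ', hθ', hγ', h1'⟩ := hk'
  have hexp : ∀ t ∈ Icc (0 : ℝ) 1, Complex.exp (θ t) = Complex.exp (θ' t) := fun t ht =>
    add_left_cancel ((hγ t ht).symm.trans (hγ' t ht))
  have h0 : (0 : ℝ) ∈ Icc (0 : ℝ) 1 := ⟨le_rfl, zero_le_one⟩
  obtain ⟨m, hm⟩ := Complex.exp_eq_exp_iff_exists_int.1 (hexp 0 h0)
  -- `θ` and the translate of `θ'` that agrees with it at `0` are lifts of the same curve
  have key : EqOn θ (fun t => θ' t + m * (2 * Real.pi * Complex.I)) (Icc 0 1) := by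
    refine Complex.isCoveringMap_exp.eqOn_of_comp_eqOn isPreconnected_Icc hθ
      (hθ'.add continuousOn_const) (fun t ht => Subtype.ext ?_) h0 hm
    simp only [Function.comp_apply]
    rw [hexp t ht]
    exact Complex.exp_eq_exp_iff_exists_int.2 ⟨-m, by push_cast; ring⟩
  have e1 := key (⟨zero_le_one, le_rfl⟩ : (1 : ℝ) ∈ Icc (0 : ℝ) 1)
  simp only at e1
  have h2 : 2 * Real.pi * Complex.I * k = 2 * Real.pi * Complex.I * k' := by
    rw [← h1, ← h1', e1, hm]; ring
  exact_mod_cast mul_left_cancel₀ Complex.two_pi_I_ne_zero h2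

theorem exists_hasWindingNumber {γ : ℝ → ℂ} {p : ℂ} (hc : ContinuousOn γ (Icc 0 1))
    (hp : ∀ t ∈ Icc (0 : ℝ) 1, γ t ≠ p) (h01 : γ 0 = γ 1) : ∃ k : ℤ, HasWindingNumber γ p k := by
  let c : C(I, {z : ℂ // z ≠ 0}) :=
    ⟨fun t => ⟨γ t - p, sub_ne_zero.2 (hp t t.2)⟩,
      Continuous.subtype_mk ((continuousOn_iff_continuous_domRestrict.1 hc).sub continuous_const) _⟩
  have hne : γ 0 - p ≠ 0 := sub_ne_zero.2 (hp 0 ⟨le_rfl, zero_le_one⟩)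
  obtain ⟨Γ, hΓ, -⟩ := Complex.isCoveringMap_exp.exists_path_lifts c (Complex.log (γ 0 - p))
    (Subtype.ext (Complex.exp_log hne).symm)
  have hexp : ∀ t : I, Complex.exp (Γ t) = γ t - p := fun t =>
    congrArg Subtype.val (congrFun hΓ t)
  have hends : Complex.exp (Γ 1) = Complex.exp (Γ 0) := by
    rw [hexp, hexp]; simp [h01]
  obtain ⟨k, hk⟩ := Complex.exp_eq_exp_iff_exists_int.1 hends
  refine ⟨k, fun t => Γ (projIcc 0 1 zero_le_one t), by fun_prop, fun t ht => ?_, ?_⟩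
  · rw [hexp, projIcc_of_mem _ ht]; simp
  · simp only [projIcc_right, projIcc_left]
    change Γ 1 - Γ 0 = _
    rw [hk]; ring

theorem HasWindingNumber.continuousOn {γ : ℝ → ℂ} {p : ℂ} {k : ℤ} (h : HasWindingNumber γ p k) :
    ContinuousOn γ (Icc 0 1) := by
  obtain ⟨θ, hθ, hγ, -⟩ := h
  exact (continuousOn_const.add hθ.cexp).congr hγ

theorem HasWindingNumber.ne {γ : ℝ → ℂ} {p : ℂ} {k : ℤ} (h : HasWindingNumber γ p k) {t : ℝ}
    (ht : t ∈ Icc (0 : ℝ) 1) : γ t ≠ p := by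
  obtain ⟨θ, -, hγ, -⟩ := h
  rw [hγ t ht]
  simp [Complex.exp_ne_zero]

theorem HasWindingNumber.closed {γ : ℝ → ℂ} {p : ℂ} {k : ℤ} (h : HasWindingNumber γ p k) :
    γ 0 = γ 1 := by
  obtain ⟨θ, -, hγ, h1⟩ := h
  have hexp : Complex.exp (θ 1) = Complex.exp (θ 0) :=
    Complex.exp_eq_exp_iff_exists_int.2 ⟨k, by linear_combination h1⟩
  rw [hγ 0 ⟨le_rfl, zero_le_one⟩, hγ 1 ⟨zero_le_one, le_rfl⟩, hexp]

theorem HasWindingNumber.congr {γ γ' : ℝ → ℂ} {p : ℂ} {k : ℤ} (h : HasWindingNumber γ p k)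
    (hγ' : EqOn γ' γ (Icc 0 1)) : HasWindingNumber γ' p k := by
  obtain ⟨θ, hθ, hγ, h1⟩ := h
  exact ⟨θ, hθ, fun t ht => (hγ' ht).trans (hγ t ht), h1⟩

/-! ### Maps that preserve winding numbers -/

/-- The radius in `PreservesWindingAt` can be replaced by an arbitrary neighbourhood. -/
theorem preservesWindingAt_of_nhds {φ : ℂ → ℂ} {z : ℂ} {U : Set ℂ} (hU : U ∈ 𝓝 z)
    (h : ∀ (γ : ℝ → ℂ) (k : ℤ), (∀ t ∈ Icc (0 : ℝ) 1, γ t ∈ U) →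
      HasWindingNumber γ z k → HasWindingNumber (φ ∘ γ) (φ z) k) : PreservesWindingAt φ z := by
  obtain ⟨r, hr, hrU⟩ := Metric.mem_nhds_iff.1 hU
  exact ⟨r, hr, fun γ k hγ => h γ k fun t ht => hrU (hγ t ht)⟩

theorem PreservesWindingAt.congr {φ ψ : ℂ → ℂ} {z : ℂ} (h : PreservesWindingAt φ z)
    (hψ : ψ =ᶠ[𝓝 z] φ) : PreservesWindingAt ψ z := by
  obtain ⟨r, hr, H⟩ := h
  refine preservesWindingAt_of_nhds (Filter.inter_mem hψ (Metric.ball_mem_nhds z hr))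
    fun γ k hγ hk => ?_
  rw [hψ.eq_of_nhds]
  exact (H γ k (fun t ht => (hγ t ht).2) hk).congr fun t ht => (hγ t ht).1

theorem PreservesWindingAt.comp {φ ψ : ℂ → ℂ} {z : ℂ} (hψ : PreservesWindingAt ψ (φ z))
    (hφ : PreservesWindingAt φ z) (hc : ContinuousAt φ z) : PreservesWindingAt (ψ ∘ φ) z := by
  obtain ⟨r, hr, H⟩ := hφ
  obtain ⟨s, hs, K⟩ := hψ
  exact preservesWindingAt_of_nhds
    (Filter.inter_mem (hc (Metric.ball_mem_nhds _ hs)) (Metric.ball_mem_nhds z hr))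
    fun γ k hγ hk => K _ k (fun t ht => (hγ t ht).1) (H γ k (fun t ht => (hγ t ht).2) hk)

/-- A continuous local inverse of a map that preserves winding numbers preserves them as well. -/
theorem PreservesWindingAt.of_rightInverse {φ ψ : ℂ → ℂ} {z : ℂ} (hφ : PreservesWindingAt φ z)
    (hz : ψ (φ z) = z) (hc : ∀ᶠ w in 𝓝 (φ z), ContinuousAt ψ w)
    (hinv : ∀ᶠ w in 𝓝 (φ z), φ (ψ w) = w) : PreservesWindingAt ψ (φ z) := by
  obtain ⟨r, hr, H⟩ := hφ
  have hball : ψ ⁻¹' Metric.ball z r ∈ 𝓝 (φ z) :=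
    hc.self_of_nhds (by rw [hz]; exact Metric.ball_mem_nhds z hr)
  refine preservesWindingAt_of_nhds (Filter.inter_mem (Filter.inter_mem hc hinv) hball)
    fun γ k hγ hk => ?_
  obtain ⟨k', hk'⟩ : ∃ k', HasWindingNumber (ψ ∘ γ) z k' := by
    refine exists_hasWindingNumber (fun t ht => ?_) (fun t ht h => hk.ne ht ?_) ?_
    · exact ContinuousAt.comp_continuousWithinAt (hγ t ht).1.1 (hk.continuousOn t ht)
    · rw [← (hγ t ht).1.2, ← h, Function.comp_apply]
    · simp only [Function.comp_apply, hk.closed]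
  have hφk' : HasWindingNumber γ (φ z) k' :=
    (H _ k' (fun t ht => (hγ t ht).2) hk').congr fun t ht => (hγ t ht).1.2.symm
  rw [hz, hk.unique hφk']
  exact hk'

/-! ### Orientation-preserving homeomorphisms -/

section Orientation

variable {S : Type*} [TopologicalSpace S] [ChartedSpace ℂ S]

theorem OrientationPreserving.comp {h₁ h₂ h₃ : S ≃ₜ S} (H₁ : OrientationPreserving h₁)
    (H₂ : OrientationPreserving h₂) (h : ∀ x, h₃ x = h₂ (h₁ x)) : OrientationPreserving h₃ := by
  intro e he e' he' p hp hp'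
  set e₁ := chartAt ℂ (h₁ p)
  have hq : h₁ p ∈ e₁.source := mem_chart_source ℂ _
  have hcont : ContinuousAt (h₁ ∘ e.symm) (e p) :=
    h₁.continuous.continuousAt.comp (e.continuousAt_symm (e.map_source hp))
  have hq' : (h₁ ∘ e.symm) (e p) = h₁ p := by simp [hp]
  have A := H₁ e he e₁ (chart_mem_atlas ℂ _) p hp hq
  have B := H₂ e₁ (chart_mem_atlas ℂ _) e' he' (h₁ p) hq (by rwa [← h])
  have hev : ∀ᶠ w in 𝓝 (e p), (h₁ ∘ e.symm) w ∈ e₁.source :=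
    hcont (e₁.open_source.mem_nhds (by rwa [hq']))
  have hC : ContinuousAt (e₁ ∘ h₁ ∘ e.symm) (e p) :=
    ContinuousAt.comp (by rw [hq']; exact e₁.continuousAt hq) hcont
  have hz : (e₁ ∘ h₁ ∘ e.symm) (e p) = e₁ (h₁ p) := by simp [hp]
  rw [← hz] at B
  refine (B.comp A hC).congr ?_
  · filter_upwards [hev] with w hw
    simp only [Function.comp_apply] at hw ⊢
    rw [e₁.left_inv hw, h]

theorem OrientationPreserving.symm {h : S ≃ₜ S} (H : OrientationPreserving h) :
    OrientationPreserving h.symm := by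
  intro e he e' he' p hp hp'
  have A := H e' he' e he (h.symm p) hp' (by simpa using hp)
  have hz : (e ∘ h ∘ e'.symm) (e' (h.symm p)) = e p := by simp [hp']
  have hep := e.map_source hp
  have hcont : ContinuousAt (h.symm ∘ e.symm) (e p) :=
    h.symm.continuous.continuousAt.comp (e.continuousAt_symm hep)
  have hev : ∀ᶠ w in 𝓝 (e p), (h.symm ∘ e.symm) w ∈ e'.source :=
    hcont (e'.open_source.mem_nhds (by simpa [hp] using hp'))
  have ht : ∀ᶠ w in 𝓝 (e p), w ∈ e.target := e.open_target.mem_nhds hep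
  have B := A.of_rightInverse (ψ := e' ∘ h.symm ∘ e.symm) (by simp [hp, hp'])
    (by
      rw [hz]
      filter_upwards [hev, ht] with w hw hw'
      exact (e'.continuousAt hw).comp
        (h.symm.continuous.continuousAt.comp (e.continuousAt_symm hw')))
    (by
      rw [hz]
      filter_upwards [hev, ht] with w hw hw'
      simp only [Function.comp_apply] at hw ⊢
      rw [e'.left_inv hw, h.apply_symm_apply, e.right_inv hw'])
  rwa [hz] at B

end Orientation

/-! ### Images of foliations and rectangles -/

section Transport

variable {S : Type*} [TopologicalSpace S]

theorem TransverseMeasure.map_comp (μ : TransverseMeasure S) (h : S ≃ₜ S) (γ : C(I, S)) :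
    (μ.map h).toFun ((h : C(S, S)).comp γ) = μ.toFun γ := by
  refine congrArg μ.toFun (ContinuousMap.ext fun t => ?_)
  simp

theorem IsTransversePair.map {μs μu : TransverseMeasure S} (H : IsTransversePair μs μu)
    (h : S ≃ₜ S) : IsTransversePair (μs.map h) (μu.map h) := by
  intro p
  obtain ⟨k, hk, φ, hp, h0, hφ⟩ := H (h.symm p)
  refine ⟨k, hk, h.symm.toOpenPartialHomeomorph.trans φ, by simpa using hp, by simpa using h0,
    fun γ hγ => ?_⟩
  exact hφ ((h.symm : C(S, S)).comp γ) fun t => by simpa using hγ t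

theorem IsPseudoAnosov.conj [ChartedSpace ℂ S] {f g h : S ≃ₜ S} {μs μu : TransverseMeasure S}
    (hf : IsPseudoAnosov f μs μu) (hh : OrientationPreserving h)
    (hg : ∀ x, g x = h (f (h.symm x))) : IsPseudoAnosov g (μs.map h) (μu.map h) where
  orientationPreserving :=
    (hh.symm.comp hf.orientationPreserving (h₃ := h.symm.trans f) fun _ => rfl).comp hh hg
  transverse := hf.transverse.map h
  stretch := by
    obtain ⟨lam, h1, H⟩ := hf.stretch
    refine ⟨lam, h1, fun γ => ?_⟩
    have hγ : (g : C(S, S)).comp γ =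
        (h : C(S, S)).comp ((f : C(S, S)).comp ((h.symm : C(S, S)).comp γ)) := by
      ext t
      simp [hg]
    rw [hγ, μs.map_comp, μu.map_comp]
    exact H _

theorem leaf_map_subset (μ : TransverseMeasure S) (h : S ≃ₜ S) (x : S) :
    h '' leaf μ x ⊆ leaf (μ.map h) (h x) := by
  rintro _ ⟨y, ⟨γ, hγ⟩, rfl⟩
  refine ⟨γ.map h.continuous, ?_⟩
  rw [← hγ, ← μ.map_comp h]
  rfl

theorem leaf_map (μ : TransverseMeasure S) (h : S ≃ₜ S) (x : S) :
    leaf (μ.map h) (h x) = h '' leaf μ x := by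
  refine Subset.antisymm ?_ (leaf_map_subset μ h x)
  rintro y ⟨γ, hγ⟩
  refine ⟨h.symm y, ⟨(γ.map h.symm.continuous).cast (h.symm_apply_apply x).symm rfl, ?_⟩, by simp⟩
  exact hγ

theorem Homeomorph.connectedComponentIn_image (h : S ≃ₜ S) (A : Set S) (x : S) :
    connectedComponentIn (h '' A) (h x) = h '' connectedComponentIn A x := by
  by_cases hx : x ∈ A
  · exact (h.image_connectedComponentIn hx).symm
  · rw [connectedComponentIn_eq_empty hx, image_empty, connectedComponentIn_eq_empty]
    rwa [h.injective.mem_set_image]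

theorem plaque_map (μ : TransverseMeasure S) (h : S ≃ₜ S) (r : Set S) (x : S) :
    plaque (μ.map h) (h '' r) (h x) = h '' plaque μ r x := by
  rw [plaque, leaf_map, ← image_inter h.injective, h.connectedComponentIn_image, plaque]

theorem TriviallyBifoliated.map {μs μu : TransverseMeasure S} {r : Set S}
    (H : TriviallyBifoliated μs μu r) (h : S ≃ₜ S) :
    TriviallyBifoliated (μs.map h) (μu.map h) (h '' r) where
  isOpen := h.isOpenMap _ H.isOpen
  isConnected := H.isConnected.image h h.continuous.continuousOn
  stable_interval := by
    rintro _ ⟨x, hx, rfl⟩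
    rw [plaque_map, ← h.image_closure]
    exact (H.stable_interval x hx).map fun e => (h.image _).symm.trans e
  unstable_interval := by
    rintro _ ⟨x, hx, rfl⟩
    rw [plaque_map, ← h.image_closure]
    exact (H.unstable_interval x hx).map fun e => (h.image _).symm.trans e
  inter := by
    rintro _ ⟨x, hx, rfl⟩ _ ⟨y, hy, rfl⟩
    obtain ⟨z, hz, e⟩ := H.inter x hx y hy
    refine ⟨h z, mem_image_of_mem h hz, ?_⟩
    rw [plaque_map, plaque_map, ← h.image_closure, ← h.image_closure, ← image_inter h.injective, e,
      image_singleton]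

theorem IsHorizontalSubrectangle.map {μs μu : TransverseMeasure S} {r H : Set S}
    (hH : IsHorizontalSubrectangle μs μu r H) (h : S ≃ₜ S) :
    IsHorizontalSubrectangle (μs.map h) (μu.map h) (h '' r) (h '' H) := by
  obtain ⟨r', hr', rfl, hsub, hpl⟩ := hH
  refine ⟨h '' r', hr'.map h, h.image_closure _, ?_, ?_⟩
  · rw [← h.image_closure]
    exact image_mono hsub
  · rintro _ ⟨x, hx, rfl⟩
    rw [plaque_map, plaque_map, hpl x hx]

theorem IsVerticalSubrectangle.map {μs μu : TransverseMeasure S} {r V : Set S}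
    (hV : IsVerticalSubrectangle μs μu r V) (h : S ≃ₜ S) :
    IsVerticalSubrectangle (μs.map h) (μu.map h) (h '' r) (h '' V) := by
  obtain ⟨r', hr', rfl, hsub, hpl⟩ := hV
  refine ⟨h '' r', hr'.map h, h.image_closure _, ?_, ?_⟩
  · rw [← h.image_closure]
    exact image_mono hsub
  · rintro _ ⟨x, hx, rfl⟩
    rw [plaque_map, plaque_map, hpl x hx]

theorem isOpen_openSquare : IsOpen openSquare := isOpen_Ioo.prod isOpen_Ioo

theorem openSquare_subset_closedSquare : openSquare ⊆ closedSquare :=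
  prod_mono Ioo_subset_Icc_self Ioo_subset_Icc_self

namespace GeometricRectangle

theorem inner_map (R : GeometricRectangle S) (h : S ≃ₜ S) : (R.map h).inner = h '' R.inner :=
  image_comp h R.param _

theorem carrier_map (R : GeometricRectangle S) (h : S ≃ₜ S) :
    (R.map h).carrier = h '' R.carrier :=
  image_comp h R.param _

theorem map_map_symm (R : GeometricRectangle S) (h : S ≃ₜ S) : (R.map h).map h.symm = R := by
  cases R
  simp [map, ← Function.comp_assoc]

theorem Below.map {R : GeometricRectangle S} {A B : Set S} (H : R.Below A B) (h : S ≃ₜ S) :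
    (R.map h).Below (h '' A) (h '' B) := fun a ha b hb hA hB =>
  H a ha b hb (h.injective.mem_set_image.1 hA) (h.injective.mem_set_image.1 hB)

theorem LeftOf.map {R : GeometricRectangle S} {A B : Set S} (H : R.LeftOf A B) (h : S ≃ₜ S) :
    (R.map h).LeftOf (h '' A) (h '' B) := fun a ha b hb hA hB =>
  H a ha b hb (h.injective.mem_set_image.1 hA) (h.injective.mem_set_image.1 hB)

theorem verticalBefore_map {R : GeometricRectangle S} {h : S ≃ₜ S} {x y : S} :
    (R.map h).VerticalBefore (h x) (h y) ↔ R.VerticalBefore x y := by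
  simp only [VerticalBefore, map, Function.comp_apply, h.injective.eq_iff]
  rfl

theorem IsRectangle.map [ChartedSpace ℂ S] {μs μu : TransverseMeasure S}
    {R : GeometricRectangle S} (H : R.IsRectangle μs μu) {h : S ≃ₜ S}
    (hh : OrientationPreserving h) : (R.map h).IsRectangle (μs.map h) (μu.map h) where
  bifoliated := by
    rw [inner_map]
    exact H.bifoliated.map h
  carrier_eq := by rw [carrier_map, inner_map, H.carrier_eq, h.image_closure]
  continuousOn := h.continuous.comp_continuousOn H.continuousOn
  locally_injective a ha := by
    obtain ⟨U, hU, hi⟩ := H.locally_injective a ha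
    exact ⟨U, hU, h.injective.comp_injOn hi⟩
  isOpenEmbedding := h.isOpenEmbedding.comp H.isOpenEmbedding
  orientationPreserving e he z hz hze := by
    set q := R.param (z.re, z.im) with hq
    set e₁ := chartAt ℂ q
    have hqe : q ∈ e₁.source := mem_chart_source ℂ _
    have A := H.orientationPreserving e₁ (chart_mem_atlas ℂ _) z hz hqe
    have B := hh e₁ (chart_mem_atlas ℂ _) e he q hqe hze
    have hcont : ContinuousAt (fun w : ℂ => R.param (w.re, w.im)) z :=
      ContinuousAt.comp (f := fun w : ℂ => (w.re, w.im)) (g := R.param)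
        (H.continuousOn.continuousAt (Filter.mem_of_superset (isOpen_openSquare.mem_nhds hz)
          openSquare_subset_closedSquare)) (by fun_prop)
    have hev : ∀ᶠ w : ℂ in 𝓝 z, R.param (w.re, w.im) ∈ e₁.source :=
      hcont (e₁.open_source.mem_nhds hqe)
    refine (PreservesWindingAt.comp B A (ContinuousAt.comp (g := e₁)
      (f := fun w : ℂ => R.param (w.re, w.im)) (e₁.continuousAt hqe) hcont)).congr ?_
    filter_upwards [hev] with w hw
    simp only [Function.comp_apply, GeometricRectangle.map]
    rw [e₁.left_inv hw]
  horizontal t ht := by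
    obtain ⟨⟨x, hx⟩, hi⟩ := H.horizontal t ht
    refine ⟨⟨h x, ?_⟩, h.injective.comp_injOn hi⟩
    rw [leaf_map]
    exact (image_comp h R.param _).trans_subset (image_mono hx)
  vertical s hs := by
    obtain ⟨⟨x, hx⟩, hi⟩ := H.vertical s hs
    refine ⟨⟨h x, ?_⟩, h.injective.comp_injOn hi⟩
    rw [leaf_map]
    exact (image_comp h R.param _).trans_subset (image_mono hx)

end GeometricRectangle

/-! ### Images of Markov partitions and of their subrectangles -/

theorem image_preimage_semiconj {f g h : S ≃ₜ S} (hg : Function.Semiconj h f g) (A : Set S) :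
    g ⁻¹' (h '' A) = h '' (f ⁻¹' A) := by
  ext x
  obtain ⟨y, rfl⟩ := h.surjective x
  rw [mem_preimage, ← hg y, h.injective.mem_set_image, h.injective.mem_set_image, mem_preimage]

theorem image_image_semiconj {f g h : S ≃ₜ S} (hg : Function.Semiconj h f g) (A : Set S) :
    g '' (h '' A) = h '' (f '' A) := by
  rw [← image_comp, ← image_comp, hg.comp_eq]

theorem IsGeometricMarkovPartition.map [ChartedSpace ℂ S] {f g h : S ≃ₜ S}
    {μs μu : TransverseMeasure S} {n : ℕ} {R : Fin n → GeometricRectangle S}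
    (hR : IsGeometricMarkovPartition f μs μu R) (hh : OrientationPreserving h)
    (hg : Function.Semiconj h f g) :
    IsGeometricMarkovPartition g (μs.map h) (μu.map h) (fun i => (R i).map h) where
  isRectangle i := (hR.isRectangle i).map hh
  cover := by
    simp only [GeometricRectangle.carrier_map, ← image_iUnion, hR.cover, image_univ,
      h.surjective.range_eq]
  disjoint i j hij := by
    simp only [GeometricRectangle.inner_map]
    exact (disjoint_image_iff h.injective).2 (hR.disjoint i j hij)
  horizontal i j := by
    simp only [GeometricRectangle.inner_map]
    rw [image_preimage_semiconj hg, ← image_inter h.injective]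
    rintro _ ⟨x, hx, rfl⟩
    rw [h.connectedComponentIn_image, ← h.image_closure]
    exact (hR.horizontal i j x hx).map h
  vertical i j := by
    simp only [GeometricRectangle.inner_map]
    rw [image_image_semiconj hg, ← image_inter h.injective]
    rintro _ ⟨x, hx, rfl⟩
    rw [h.connectedComponentIn_image, ← h.image_closure]
    exact (hR.vertical i j x hx).map h

theorem componentClosures_image (h : S ≃ₜ S) (A : Set S) :
    componentClosures (h '' A) = image h '' componentClosures A := by
  ext K
  constructor
  · rintro ⟨_, ⟨x, hx, rfl⟩, rfl⟩
    exact ⟨_, ⟨x, hx, rfl⟩, by rw [h.connectedComponentIn_image, h.image_closure]⟩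
  · rintro ⟨_, ⟨x, hx, rfl⟩, rfl⟩
    exact ⟨h x, mem_image_of_mem h hx, by rw [h.connectedComponentIn_image, h.image_closure]⟩

theorem horizontalSubrectangles_map {f g h : S ≃ₜ S} (hg : Function.Semiconj h f g) {n : ℕ}
    (R : Fin n → GeometricRectangle S) (i : Fin n) :
    horizontalSubrectangles g (fun i => (R i).map h) i =
      image h '' horizontalSubrectangles f R i := by
  simp only [horizontalSubrectangles, GeometricRectangle.inner_map, image_preimage_semiconj hg]
  rw [← image_iUnion, ← image_inter h.injective, componentClosures_image]

theorem verticalSubrectangles_map {f g h : S ≃ₜ S} (hg : Function.Semiconj h f g) {n : ℕ}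
    (R : Fin n → GeometricRectangle S) (k : Fin n) :
    verticalSubrectangles g (fun i => (R i).map h) k = image h '' verticalSubrectangles f R k := by
  simp only [verticalSubrectangles, GeometricRectangle.inner_map, image_image_semiconj hg]
  rw [← image_iUnion, ← image_inter h.injective, componentClosures_image]

theorem preservesVerticalDirection_map {f g h : S ≃ₜ S} (hg : Function.Semiconj h f g)
    {R R' : GeometricRectangle S} {H : Set S} :
    PreservesVerticalDirection g (R.map h) (R'.map h) (h '' H) ↔
      PreservesVerticalDirection f R R' H := by
  simp only [PreservesVerticalDirection, forall_mem_image, GeometricRectangle.inner_map, ← hg.eq,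
    h.injective.mem_set_image, GeometricRectangle.verticalBefore_map]

theorem IsGeometricTypeOf.map {f g h : S ≃ₜ S} (hg : Function.Semiconj h f g) {n : ℕ}
    {T : GeometricType n} {R : Fin n → GeometricRectangle S} (H : IsGeometricTypeOf T f R) :
    IsGeometricTypeOf T g (fun i => (R i).map h) := by
  obtain ⟨H, V, hH, hV, hρ, hε⟩ := H
  have hinj : (image h : Set S → Set S).Injective := h.injective.image_injective
  refine ⟨fun i j => h '' H i j, fun k l => h '' V k l, fun i => ⟨?_, ?_, ?_⟩,
    fun k => ⟨?_, ?_, ?_⟩, fun a b => ?_, fun a => ?_⟩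
  · exact hinj.comp (hH i).1
  · rw [horizontalSubrectangles_map hg, ← (hH i).2.1, ← range_comp]
    rfl
  · exact fun j j' hj => ((hH i).2.2 j j' hj).map h
  · exact hinj.comp (hV k).1
  · rw [verticalSubrectangles_map hg, ← (hV k).2.1, ← range_comp]
    rfl
  · exact fun l l' hl => ((hV k).2.2 l l' hl).map h
  · rw [image_image_semiconj hg, hinj.eq_iff, hρ]
  · rw [preservesVerticalDirection_map hg, hε]

/-! ### Uniqueness of the geometric type -/

/-- A set has at most one enumeration by an initial segment of `ℕ` that is compatible with a
relation which is antisymmetric on this set. -/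
theorem enumeration_unique {α : Type*} {r : α → α → Prop} {s : Set α}
    (hr : ∀ x ∈ s, ∀ y ∈ s, r x y → ¬ r y x) {a b : ℕ} {F : Fin a → α} {G : Fin b → α}
    (hF : F.Injective) (hFs : range F = s) (hFr : ∀ j j', j < j' → r (F j) (F j'))
    (hG : G.Injective) (hGs : range G = s) (hGr : ∀ j j', j < j' → r (G j) (G j')) :
    ∃ e : a = b, ∀ j, G (Fin.cast e j) = F j := by
  have hex : ∀ j, ∃ j', G j' = F j := fun j =>
    hGs.symm.subset (hFs.subset (mem_range_self j))
  choose τ hτ using hex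
  have hmono : StrictMono τ := by
    intro j j' hj
    by_contra hle
    rcases (not_lt.1 hle).eq_or_lt with heq | hlt
    · exact hj.ne (hF (by rw [← hτ, ← hτ, heq]))
    · have h1 := hGr _ _ hlt
      rw [hτ, hτ] at h1
      exact hr _ (hFs.subset (mem_range_self j)) _ (hFs.subset (mem_range_self j'))
        (hFr _ _ hj) h1
  have hsurj : τ.Surjective := fun k => by
    obtain ⟨j, hj⟩ := hFs.symm.subset (hGs.subset (mem_range_self k))
    exact ⟨j, hG (by rw [hτ, hj])⟩
  have e : a = b := by
    simpa using Fintype.card_of_bijective ⟨hmono.injective, hsurj⟩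
  subst e
  refine ⟨rfl, fun j => ?_⟩
  have : hmono.orderIsoOfSurjective τ hsurj = OrderIso.refl _ := Subsingleton.elim _ _
  have hj : τ j = j := congrArg (fun o : Fin a ≃o Fin a => o j) this
  rw [Fin.cast_eq_self, ← hτ, hj]

/-- A nonempty open subset of the interior of a rectangle contains two points at distinct heights
and two points at distinct horizontal positions. -/
theorem GeometricRectangle.exists_ne_of_isOpen {R : GeometricRectangle S}
    (hc : ContinuousOn R.param closedSquare) {A : Set S} (hA : IsOpen A) (hAR : A ⊆ R.inner)
    (hne : A.Nonempty) : ∃ a ∈ openSquare, ∃ b ∈ openSquare, R.param a ∈ A ∧ R.param b ∈ A ∧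
      a.1 ≠ b.1 ∧ a.2 ≠ b.2 := by
  obtain ⟨x, hx⟩ := hne
  obtain ⟨a, ha, rfl⟩ := hAR hx
  have hU : openSquare ∩ R.param ⁻¹' A ∈ 𝓝 a :=
    ((hc.mono openSquare_subset_closedSquare).isOpen_inter_preimage isOpen_openSquare
      hA).mem_nhds ⟨ha, hx⟩
  rw [← Prod.mk.eta (p := a), nhds_prod_eq] at hU
  obtain ⟨U, hU, V, hV, hUV⟩ := Filter.mem_prod_iff.1 hU
  have hdense : ∀ (c : ℝ), ∀ W ∈ 𝓝 c, ∃ d ∈ W, c ≠ d := fun c W hW => by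
    obtain ⟨d, hd, hdc⟩ := (mem_closure_iff_nhds.1
      ((dense_compl_singleton c).closure_eq ▸ mem_univ c)) W hW
    exact ⟨d, hd, fun h => hdc h.symm⟩
  obtain ⟨s, hs, hs'⟩ := hdense _ U hU
  obtain ⟨t, ht, ht'⟩ := hdense _ V hV
  have hb := hUV (mk_mem_prod hs ht)
  exact ⟨a, ha, (s, t), hb.1, hx, hb.2, hs', ht'⟩

theorem GeometricRectangle.exists_ne_of_mem_componentClosures [LocallyConnectedSpace S]
    {R : GeometricRectangle S} (hc : ContinuousOn R.param closedSquare) {B : Set S}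
    (hB : IsOpen B) (hBR : B ⊆ R.inner) {K : Set S} (hK : K ∈ componentClosures B) :
    ∃ a ∈ openSquare, ∃ b ∈ openSquare, R.param a ∈ K ∧ R.param b ∈ K ∧
      a.1 ≠ b.1 ∧ a.2 ≠ b.2 := by
  obtain ⟨x, hx, rfl⟩ := hK
  obtain ⟨a, ha, b, hb, haK, hbK, h⟩ := R.exists_ne_of_isOpen hc hB.connectedComponentIn
    ((connectedComponentIn_subset _ _).trans hBR) ⟨x, mem_connectedComponentIn hx⟩
  exact ⟨a, ha, b, hb, subset_closure haK, subset_closure hbK, h⟩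

/-- Two parameters neither of which comes strictly before the other are equal. -/
theorem GeometricRectangle.eq_of_not_before {X : Type*} {R : GeometricRectangle X} {s t : ℝ}
    (h : ¬ R.Before s t) (h' : ¬ R.Before t s) : s = t := by
  simp only [Before, not_lt] at h h'
  rcases Int.units_eq_one_or R.dir with hd | hd <;> rw [hd] at h h' <;> push_cast at h h' <;>
    linarith

theorem GeometricRectangle.Below.asymm [LocallyConnectedSpace S] {R : GeometricRectangle S}
    (hc : ContinuousOn R.param closedSquare) {B : Set S} (hB : IsOpen B) (hBR : B ⊆ R.inner)
    {K L : Set S} (hK : K ∈ componentClosures B) (hL : L ∈ componentClosures B)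
    (h : R.Below K L) : ¬ R.Below L K := by
  intro h'
  obtain ⟨a, ha, b, hb, haK, hbK, -, hne⟩ := R.exists_ne_of_mem_componentClosures hc hB hBR hK
  obtain ⟨c, hcs, -, -, hcL, -⟩ := R.exists_ne_of_mem_componentClosures hc hB hBR hL
  exact hne ((eq_of_not_before (h' c hcs a ha hcL haK) (h a ha c hcs haK hcL)).trans
    (eq_of_not_before (h b hb c hcs hbK hcL) (h' c hcs b hb hcL hbK)))

theorem GeometricRectangle.LeftOf.asymm [LocallyConnectedSpace S] {R : GeometricRectangle S}
    (hc : ContinuousOn R.param closedSquare) {B : Set S} (hB : IsOpen B) (hBR : B ⊆ R.inner)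
    {K L : Set S} (hK : K ∈ componentClosures B) (hL : L ∈ componentClosures B)
    (h : R.LeftOf K L) : ¬ R.LeftOf L K := by
  intro h'
  obtain ⟨a, ha, b, hb, haK, hbK, hne, -⟩ := R.exists_ne_of_mem_componentClosures hc hB hBR hK
  obtain ⟨c, hcs, -, -, hcL, -⟩ := R.exists_ne_of_mem_componentClosures hc hB hBR hL
  exact hne ((eq_of_not_before (h' c hcs a ha hcL haK) (h a ha c hcs haK hcL)).trans
    (eq_of_not_before (h b hb c hcs hbK hcL) (h' c hcs b hb hcL hbK)))

theorem IsGeometricTypeOf.unique [ChartedSpace ℂ S] {f : S ≃ₜ S} {μs μu : TransverseMeasure S}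
    {n : ℕ} {R : Fin n → GeometricRectangle S} (hR : IsGeometricMarkovPartition f μs μu R)
    {T T' : GeometricType n} (hT : IsGeometricTypeOf T f R) (hT' : IsGeometricTypeOf T' f R) :
    T = T' := by
  have : LocallyConnectedSpace S := ChartedSpace.locallyConnectedSpace ℂ S
  obtain ⟨h, v, ρ, ε⟩ := T
  obtain ⟨h', v', ρ', ε'⟩ := T'
  obtain ⟨H, V, hH, hV, hρ, hε⟩ := hT
  obtain ⟨H', V', hH', hV', hρ', hε'⟩ := hT'
  dsimp only at H V hH hV hρ hε H' V' hH' hV' hρ' hε'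
  have hin : ∀ i, IsOpen (R i).inner := fun i => (hR.isRectangle i).bifoliated.isOpen
  have eH : ∀ i, ∃ e : h i = h' i, ∀ j, H' i (Fin.cast e j) = H i j := fun i =>
    enumeration_unique (r := (R i).Below) (s := horizontalSubrectangles f R i)
      (fun K hK L hL => GeometricRectangle.Below.asymm (hR.isRectangle i).continuousOn
        ((hin i).inter (isOpen_iUnion fun j => (hin j).preimage f.continuous)) inter_subset_left
        hK hL)
      (hH i).1 (hH i).2.1 (hH i).2.2 (hH' i).1 (hH' i).2.1 (hH' i).2.2
  have eV : ∀ k, ∃ e : v k = v' k, ∀ l, V' k (Fin.cast e l) = V k l := fun k =>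
    enumeration_unique (r := (R k).LeftOf) (s := verticalSubrectangles f R k)
      (fun K hK L hL => GeometricRectangle.LeftOf.asymm (hR.isRectangle k).continuousOn
        ((hin k).inter (isOpen_iUnion fun j => f.isOpenMap _ (hin j))) inter_subset_left
        hK hL)
      (hV k).1 (hV k).2.1 (hV k).2.2 (hV' k).1 (hV' k).2.1 (hV' k).2.2
  obtain rfl : h = h' := funext fun i => (eH i).1
  obtain rfl : v = v' := funext fun k => (eV k).1
  obtain rfl : H' = H := funext fun i => funext fun j => (eH i).2 j
  obtain rfl : V' = V := funext fun k => funext fun l => (eV k).2 l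
  obtain rfl : ρ = ρ' := Equiv.ext fun a => (hρ a _).2 ((hρ' a _).1 rfl)
  obtain rfl : ε = ε' := by
    funext a
    have h1 : ε a = 1 ↔ ε' a = 1 := (hε a).trans (hε' a).symm
    rcases Int.units_eq_one_or (ε a) with h2 | h2
    · rw [h2, h1.1 h2]
    · rcases Int.units_eq_one_or (ε' a) with h3 | h3
      · rw [h3, h1.2 h3]
      · rw [h2, h3]
  rfl

end Transport

theorem mainTheorem10 {S : Type*} [TopologicalSpace S] [T2Space S] [CompactSpace S]
    [ChartedSpace ℂ S] [OrientedSurface S]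
    (f g h : S ≃ₜ S) (hh : OrientationPreserving h) (hg : ∀ x, g x = h (f (h.symm x)))
    (μs μu : TransverseMeasure S) (hf : IsPseudoAnosov f μs μu)
    {n : ℕ} (R : Fin n → GeometricRectangle S) (hR : IsGeometricMarkovPartition f μs μu R) :
    IsPseudoAnosov g (μs.map h) (μu.map h) ∧
      IsGeometricMarkovPartition g (μs.map h) (μu.map h) (fun i => (R i).map h) ∧
      (∀ T : GeometricType n,
        IsGeometricTypeOf T f R ↔ IsGeometricTypeOf T g (fun i => (R i).map h)) ∧
      (∀ T T' : GeometricType n, IsGeometricTypeOf T f R →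
        IsGeometricTypeOf T' g (fun i => (R i).map h) → T = T') := by
  have hsemi : Function.Semiconj h f g := fun x => by rw [hg, h.symm_apply_apply]
  have hsemi' : Function.Semiconj h.symm g f := fun x => by rw [hg, h.symm_apply_apply]
  have hiff : ∀ T : GeometricType n,
      IsGeometricTypeOf T f R ↔ IsGeometricTypeOf T g (fun i => (R i).map h) := fun T => by
    refine ⟨IsGeometricTypeOf.map hsemi, fun hT => ?_⟩
    simpa only [GeometricRectangle.map_map_symm] using hT.map hsemi'
  exact ⟨hf.conj hh hg, hR.map hh hsemi, hiff, fun T T' hT hT' => hT.unique hR ((hiff T').2 hT')⟩
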